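/- **Setting.** Let $\mathcal A$ be a finite alphabet with $d\ge 2$ letters. An AIET $T=(\pi,\eta,\omega)$ is given by an irreducible pair $\pi=(\pi_0,\pi_1)$ of bijections $\mathcal A\to\{1,\dots,d\}$ (the orders of the intervals before and after the exchange), lengths $\eta_\alpha>0$ and log-slopes $\omega_\alpha\in\mathbb R$ with $\sum_\alpha\eta_\alpha e^{\omega_\alpha}=\sum_\alpha\eta_\alpha$; it is the bijection of $[0,|\eta|_1)$ that maps the interval $I_\alpha$ affinely, with slope $e^{\omega_\alpha}$, onto the interval with letter $\alpha$ in the order $\pi_1$. It is an IET if $\omega=0$, and normalized if $|\eta|_1=1$. One step of Rauzy–Veech induction $\mathcal{RV}$ replaces $T$ by its first return map to the domain deprived of the shorter of $I_{\pi_0^{-1}(d)}$ and $T(I_{\pi_1^{-1}(d)})$; the type is $\varepsilon=0$ if the first one is longer and $\varepsilon=1$ if the second one is, the winner is $\pi_\varepsilon^{-1}(d)$ and the loser is $\pi_{1-\varepsilon}^{-1}(d)$ (the step is undefined in case of equality). If $T^{(n)}=\mathcal{RV}^n(T)$ is defined for all $n$, the combinatorial rotation number $\gamma(T)$ is the infinite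 path followed in the Rauzy graph, i.e. the sequence of the permutation data $\pi^{(n)}$ and types of $T^{(n)}$. It is $\infty$-complete if every letter is the winner infinitely often. Put $A(T)=\mathrm{Id}+E_{\text{winner},\text{loser}}$ and $Q_{m,n}=A(T^{(n-1)})^{\mathsf T}\cdots A(T^{(m)})^{\mathsf T}$ for $n\ge m$. Let $t_n$ be the number of Rauzy–Veech steps in the first $n$ steps of the Zorich acceleration (each of which groups a maximal run of equal types); the Zorich cocycle is $Q_{0,t_n}$, and the exponent of $v\in\mathbb R^{\mathcal A}\setminus\{0\}$ is $\theta(v)=\lim_{n}\frac1n\log|Q_{0,t_n}v|_1$. $T_0$ is Oseledets generic if $\theta(v)$ exists in $\mathbb R$ for all $v\ne0$, and $E_{cs}(T_0)=\{0\}\cup\{v:\theta(v)\le 0\}$. An IET $T_0$ satisfies the *BC condition* if it satisfies Keane's condition, is Oseledets generic, $\gamma(T_0)$ is $\infty$-complete, and there is a strictly increasing sequence $(n_k)_{k\in\mathbb N}$ in $\mathbb N$ such that 1. there are $N\in\mathbb N$ and $K>0$ with $1\le (Q_{n_k,n_k+N})_{\alpha\beta}\le K$ for all $\alpha,\beta\in\mathcal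 A$ and all $k$; 2. there is $V>0$ with $\big\|Q_{0,n_k}|_{E_{cs}(T_0)}\big\|\le V$ for all $k$. $\mathrm{Aff}(\gamma,\omega)$ denotes the set of normalized AIETs with log-slope vector $\omega$ and combinatorial rotation number $\gamma$. For an AIET $T$ and $\omega\in\mathbb R^{\mathcal A}$ let $f_{T,\omega}=\omega_\alpha$ on $I_\alpha$, and let $S^T_nf=\sum_{j=0}^{n-1}f\circ T^j$ for $n\ge0$ and $S^T_nf=-\sum_{j=n}^{-1}f\circ T^{j}$ for $n<0$. **Proposition.** Let $T_0$ be an IET satisfying the BC condition and let $\omega\in E_{cs}(T_0)$. Then for every AIET $T\in\mathrm{Aff}(\gamma(T_0),\omega)$ and every $x\in[0,1)$ there is a sequence $(m_k)_{k\in\mathbb Z}$ of integers with $m_k\to+\infty$ as $k\to+\infty$ and $m_k\to-\infty$ as $k\to-\infty$ (in particular $|m_k|\to\infty$ as $|k|\to\infty$) such that $$\sup_{k\in\mathbb Z}\big|S^T_{m_k}f_{T,\omega}(x)\big|<+\infty .$$ -/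

import Mathlib

open Filter Topology

noncomputable section

/-! ## Combinatorial data and the Rauzy graph

The alphabet `A` is a finite type with `d = Fintype.card A ≥ 2` letters (`Nontrivial A`). Positions
are numbered `0, …, d - 1` instead of `1, …, d`. -/

/-- A pair `π = (π₀, π₁)` of bijections from the alphabet to the positions: `top = π₀` is the order
of the intervals before the exchange and `bot = π₁` the order after it. -/
@[ext]
structure PermPair (A : Type*) [Fintype A] where
  top : A ≃ Fin (Fintype.card A)
  bot : A ≃ Fin (Fintype.card A)

namespace PermPair

variable {A : Type*} [Fintype A]

/-- `π₁ ∘ π₀⁻¹ ({1, …, k}) = {1, …, k}` implies `k = d`, for `1 ≤ k ≤ d`. -/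
def Irreducible (π : PermPair A) : Prop :=
  ∀ k : ℕ, 1 ≤ k → k ≤ Fintype.card A →
    (fun i => π.bot (π.top.symm i)) '' {i | (i : ℕ) < k} =
      {i : Fin (Fintype.card A) | (i : ℕ) < k} → k = Fintype.card A

variable [Nontrivial A]

/-- The last position. -/
def lastPos (A : Type*) [Fintype A] [Nontrivial A] : Fin (Fintype.card A) :=
  ⟨Fintype.card A - 1, Nat.sub_lt Fintype.card_pos one_pos⟩

/-- `π₀⁻¹(d)`, the letter of the last interval before the exchange. -/
def lastTop (π : PermPair A) : A := π.top.symm (lastPos A)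

/-- `π₁⁻¹(d)`, the letter of the last interval after the exchange. -/
def lastBot (π : PermPair A) : A := π.bot.symm (lastPos A)

/-- The winner of a Rauzy move of type `ε` is `π_ε⁻¹(d)`. -/
def winner (π : PermPair A) (ε : Fin 2) : A := if ε = 0 then π.lastTop else π.lastBot

/-- The loser of a Rauzy move of type `ε` is `π_{1-ε}⁻¹(d)`. -/
def loser (π : PermPair A) (ε : Fin 2) : A := if ε = 0 then π.lastBot else π.lastTop

/-- The permutation of the positions that moves the last one to the place immediately after `p`,
shifts the positions strictly between `p` and the last one by one to the right, and fixes the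
positions up to `p`. -/
def moveLastAfter (p : Fin (Fintype.card A)) : Equiv.Perm (Fin (Fintype.card A)) :=
  if h : (p : ℕ) + 1 < Fintype.card A then Fin.cycleIcc ⟨p + 1, h⟩ (lastPos A) else 1

/-- The arrows of the Rauzy graph: a move of type `0` keeps `π₀` and moves the loser in `π₁`
to the place immediately after the winner; a move of type `1` does so with `π₀` and `π₁`
exchanged. -/
def rauzyMove (π : PermPair A) (ε : Fin 2) : PermPair A :=
  if ε = 0 then
    { top := π.top, bot := π.bot.trans (moveLastAfter (π.bot (π.winner ε))) }
  else
    { top := π.top.trans (moveLastAfter (π.top (π.winner ε))), bot := π.bot }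

end PermPair

/-- An infinite path in the Rauzy graph, as the sequence of its vertices and of the types of its
arrows. -/
abbrev RauzyPath (A : Type*) [Fintype A] := ℕ → PermPair A × Fin 2

/-- Every letter is the winner of infinitely many arrows of the path. -/
def RauzyPath.InftyComplete {A : Type*} [Fintype A] [Nontrivial A] (γ : RauzyPath A) : Prop :=
  ∀ α : A, ∃ᶠ n in atTop, (γ n).1.winner (γ n).2 = α

/-! ## Affine interval exchange data and Rauzy-Veech induction -/

/-- The raw parameters `(π, η, ω)` of an affine interval exchange on an interval `[0, |η|)`. -/
structure ExchangeData (A : Type*) [Fintype A] where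
  perm : PermPair A
  len : A → ℝ
  logSlope : A → ℝ

namespace ExchangeData

variable {A : Type*} [Fintype A]

/-- The length of the domain. -/
def total (D : ExchangeData A) : ℝ := ∑ α, D.len α

/-- The length `e^{ω_α} η_α` of the image of the interval `I_α`. -/
def imageLen (D : ExchangeData A) (α : A) : ℝ := Real.exp (D.logSlope α) * D.len α

/-- The left end point of the interval with letter `α`, when intervals of lengths `ℓ` are put side
by side from `0` on in the order `σ`. -/
def leftEnd (σ : A ≃ Fin (Fintype.card A)) (ℓ : A → ℝ) (α : A) : ℝ :=
  ∑ β with σ β < σ α, ℓ β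

/-- The exchanged interval `I_α`. -/
def interval (D : ExchangeData A) (α : A) : Set ℝ :=
  Set.Ico (leftEnd D.perm.top D.len α) (leftEnd D.perm.top D.len α + D.len α)

open Classical in
/-- The piecewise affine map: it sends `I_α` onto the interval with letter `α` in the order `π₁`
by an affine map of slope `e^{ω_α}` (and it is `0` off the domain). -/
def map (D : ExchangeData A) (x : ℝ) : ℝ :=
  ∑ α, if x ∈ D.interval α then
    leftEnd D.perm.bot D.imageLen α
      + Real.exp (D.logSlope α) * (x - leftEnd D.perm.top D.len α)
  else 0

open Classical in
/-- The piecewise constant function `f_{T, v}`, equal to `v_α` on `I_α`. -/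
def stepFun (D : ExchangeData A) (v : A → ℝ) (x : ℝ) : ℝ :=
  ∑ α, if x ∈ D.interval α then v α else 0

/-- Keane's condition: no left end point of an exchanged interval is sent by a positive
iterate to a left end point of an interval other than the first one. -/
def Keane (D : ExchangeData A) : Prop :=
  ∀ m : ℕ, 1 ≤ m → ∀ α β : A, (D.perm.top β : ℕ) ≠ 0 →
    D.map^[m] (leftEnd D.perm.top D.len α) ≠ leftEnd D.perm.top D.len β

variable [Nontrivial A]

/-- The type: `0` if the last interval `I_{π₀⁻¹(d)}` is longer than the last image interval
`T(I_{π₁⁻¹(d)})`, and `1` if it is shorter. -/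
def type (D : ExchangeData A) : Fin 2 :=
  if D.imageLen D.perm.lastBot < D.len D.perm.lastTop then 0 else 1

/-- The case of equality, in which the induction step is not defined. -/
def Tie (D : ExchangeData A) : Prop := D.len D.perm.lastTop = D.imageLen D.perm.lastBot

def winner (D : ExchangeData A) : A := D.perm.winner D.type

def loser (D : ExchangeData A) : A := D.perm.loser D.type

variable [DecidableEq A]

/-- One step of Rauzy-Veech induction: the parameters of the first return map to the domain
deprived of the shorter one of the two last intervals. It is meant for data without `Tie`. -/
def rauzy (D : ExchangeData A) : ExchangeData A where
  perm := D.perm.rauzyMove D.type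
  len := fun α =>
    if D.type = 0 then
      if α = D.winner then D.len α - D.imageLen D.loser else D.len α
    else
      if α = D.winner then D.len α - Real.exp (-D.logSlope D.winner) * D.len D.loser
      else if α = D.loser then Real.exp (-D.logSlope D.winner) * D.len α
      else D.len α
  logSlope := fun α =>
    if α = D.loser then D.logSlope D.loser + D.logSlope D.winner else D.logSlope α

/-- All the steps of the induction are defined. -/
def InfinitelyRenormalizable (D : ExchangeData A) : Prop :=
  ∀ n : ℕ, ¬ (rauzy^[n] D).Tie

/-- The combinatorial rotation number `γ(T)`: the path in the Rauzy graph followed by the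
Rauzy-Veech orbit. -/
def rotationNumber (D : ExchangeData A) : RauzyPath A :=
  fun n => ((rauzy^[n] D).perm, (rauzy^[n] D).type)

/-! ## The cocycles -/

/-- `A(T) = Id + E_{winner, loser}`. -/
def rauzyMatrix (D : ExchangeData A) : Matrix A A ℤ := 1 + Matrix.single D.winner D.loser 1

/-- The height cocycle over Rauzy-Veech induction, i.e. the incidence matrix
`(Aᵀ)_{m,n} = A(T⁽ⁿ⁻¹⁾)ᵀ ⋯ A(T⁽ᵐ⁾)ᵀ` for `n ≥ m` (the identity for `n ≤ m`). -/
def heightCocycle (D : ExchangeData A) (m : ℕ) : ℕ → Matrix A A ℤ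
  | 0 => 1
  | n + 1 => if m ≤ n then (rauzyMatrix (rauzy^[n] D)).transpose * heightCocycle D m n else 1

/-- `z(T)`, the largest `z` such that the first `z` elements of the Rauzy-Veech orbit have the
same type. -/
def zorichSteps (D : ExchangeData A) : ℕ :=
  sSup {z : ℕ | ∀ i < z, (rauzy^[i] D).type = D.type}

/-- The number of Rauzy-Veech steps that make up the first `n` steps of the Zorich acceleration. -/
def zorichTime (D : ExchangeData A) : ℕ → ℕ
  | 0 => 0
  | n + 1 => zorichTime D n + zorichSteps (rauzy^[zorichTime D n] D)

/-- The height cocycle `(Bᵀ)_{0,n}` over the Zorich acceleration (the Zorich cocycle). -/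
def zorichCocycle (D : ExchangeData A) (n : ℕ) : Matrix A A ℤ :=
  D.heightCocycle 0 (D.zorichTime n)

end ExchangeData

/-- The real vector `M v` for an integer matrix `M`. -/
def intMulVec {A : Type*} [Fintype A] (M : Matrix A A ℤ) (v : A → ℝ) : A → ℝ :=
  (M.map (Int.cast : ℤ → ℝ)).mulVec v

/-- `|v|₁`. -/
def l1Norm {A : Type*} [Fintype A] (v : A → ℝ) : ℝ := ∑ α, |v α|

namespace ExchangeData

variable {A : Type*} [Fintype A] [Nontrivial A] [DecidableEq A]

/-- `θ` is the Lyapunov exponent of `v` for the Zorich cocycle. -/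
def HasExponent (D : ExchangeData A) (v : A → ℝ) (θ : ℝ) : Prop :=
  Tendsto (fun n : ℕ => Real.log (l1Norm (intMulVec (D.zorichCocycle n) v)) / n) atTop (𝓝 θ)

/-- Oseledets genericity for the Zorich cocycle: every nonzero vector has a Lyapunov exponent.
(The filtration is then the one given by the sublevel sets of the exponent.) -/
def OseledetsGeneric (D : ExchangeData A) : Prop :=
  ∀ v : A → ℝ, v ≠ 0 → ∃ θ : ℝ, D.HasExponent v θ

/-- The central stable space `E_cs`: the zero vector and the vectors with a zero or negative
Lyapunov exponent. -/
def centralStable (D : ExchangeData A) : Set (A → ℝ) :=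
  {v | v = 0 ∨ ∃ θ : ℝ, θ ≤ 0 ∧ D.HasExponent v θ}

/-- The Bounded Central Condition. The bound in the last clause says that the operator norm of the
restriction of the cocycle to `E_cs` is at most `V`. -/
def BCCondition (D : ExchangeData A) : Prop :=
  D.Keane ∧ D.OseledetsGeneric ∧ D.rotationNumber.InftyComplete ∧
  ∃ n : ℕ → ℕ, StrictMono n ∧
    (∃ (N : ℕ) (K : ℝ), 0 < K ∧ ∀ (k : ℕ) (α β : A),
      1 ≤ D.heightCocycle (n k) (n k + N) α β ∧
        (D.heightCocycle (n k) (n k + N) α β : ℝ) ≤ K) ∧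
    (∃ V : ℝ, 0 < V ∧ ∀ (k : ℕ), ∀ v ∈ D.centralStable,
      l1Norm (intMulVec (D.heightCocycle 0 (n k)) v) ≤ V * l1Norm v)

end ExchangeData

/-! ## Affine interval exchange transformations -/

/-- An affine interval exchange transformation, in its standard parametrization. -/
structure AIET (A : Type*) [Fintype A] extends ExchangeData A where
  irreducible : perm.Irreducible
  len_pos : ∀ α, 0 < len α
  balance : ∑ α, len α * Real.exp (logSlope α) = ∑ α, len α

section Intervals

variable {A : Type*} [Fintype A]

lemma ExchangeData.leftEnd_add_le (σ : A ≃ Fin (Fintype.card A)) {ℓ : A → ℝ} (hℓ : ∀ α, 0 < ℓ α)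
    {α β : A} (h : σ α < σ β) : leftEnd σ ℓ α + ℓ α ≤ leftEnd σ ℓ β := by
  classical
  unfold leftEnd
  have hn : α ∉ Finset.univ.filter (fun γ => σ γ < σ α) := by simp
  rw [add_comm, ← Finset.sum_insert hn]
  refine Finset.sum_le_sum_of_subset_of_nonneg ?_ (fun γ _ _ => (hℓ γ).le)
  intro γ
  simp only [Finset.mem_insert, Finset.mem_filter, Finset.mem_univ, true_and]
  rintro (rfl | hγ)
  · exact h
  · exact hγ.trans h

lemma ExchangeData.leftEnd_nonneg (σ : A ≃ Fin (Fintype.card A)) {ℓ : A → ℝ}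
    (hℓ : ∀ α, 0 < ℓ α) (α : A) : 0 ≤ leftEnd σ ℓ α :=
  Finset.sum_nonneg fun γ _ => (hℓ γ).le

lemma ExchangeData.leftEnd_add_le_sum (σ : A ≃ Fin (Fintype.card A)) {ℓ : A → ℝ}
    (hℓ : ∀ α, 0 < ℓ α) (α : A) : leftEnd σ ℓ α + ℓ α ≤ ∑ β, ℓ β := by
  classical
  unfold leftEnd
  have hn : α ∉ Finset.univ.filter (fun γ => σ γ < σ α) := by simp
  rw [add_comm, ← Finset.sum_insert hn]
  exact Finset.sum_le_sum_of_subset_of_nonneg (Finset.subset_univ _) (fun γ _ _ => (hℓ γ).le)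

lemma ExchangeData.eq_of_mem_of_mem (σ : A ≃ Fin (Fintype.card A)) {ℓ : A → ℝ}
    (hℓ : ∀ α, 0 < ℓ α) {α β : A} {x : ℝ}
    (hα : x ∈ Set.Ico (leftEnd σ ℓ α) (leftEnd σ ℓ α + ℓ α))
    (hβ : x ∈ Set.Ico (leftEnd σ ℓ β) (leftEnd σ ℓ β + ℓ β)) : α = β := by
  rcases lt_trichotomy (σ α) (σ β) with h | h | h
  · have := leftEnd_add_le σ hℓ h
    linarith [hα.2, hβ.1]
  · exact σ.injective h
  · have := leftEnd_add_le σ hℓ h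
    linarith [hα.1, hβ.2]

lemma ExchangeData.exists_mem_Ico (σ : A ≃ Fin (Fintype.card A)) {ℓ : A → ℝ}
    {x : ℝ} (hx : x ∈ Set.Ico 0 (∑ β, ℓ β)) :
    ∃ α, x ∈ Set.Ico (leftEnd σ ℓ α) (leftEnd σ ℓ α + ℓ α) := by
  classical
  by_contra! hcon
  have key : ∀ k : ℕ, k ≤ Fintype.card A →
      ∑ β ∈ Finset.univ.filter (fun β => (σ β : ℕ) < k), ℓ β ≤ x := by
    intro k
    induction k with
    | zero => intro _; simpa using hx.1
    | succ k ih =>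
      intro hk
      have h1 := ih (by omega)
      set α := σ.symm ⟨k, hk⟩ with hα
      have hσ : σ α = ⟨k, hk⟩ := by simp [hα]
      have e1 : leftEnd σ ℓ α = ∑ β ∈ Finset.univ.filter (fun β => (σ β : ℕ) < k), ℓ β := by
        unfold leftEnd
        rw [hσ]
        rfl
      have e2 : Finset.univ.filter (fun β => (σ β : ℕ) < k + 1)
          = insert α (Finset.univ.filter (fun β => (σ β : ℕ) < k)) := by
        ext β
        simp only [Finset.mem_insert, Finset.mem_filter, Finset.mem_univ, true_and]
        constructor
        · intro h
          rcases Nat.lt_succ_iff_lt_or_eq.mp h with h | h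
          · exact Or.inr h
          · exact Or.inl (σ.injective (by rw [hσ]; exact Fin.ext h))
        · rintro (rfl | h)
          · rw [hσ]; exact Nat.lt_succ_self k
          · omega
      have hn : α ∉ Finset.univ.filter (fun β => (σ β : ℕ) < k) := by simp [hσ]
      rw [e2, Finset.sum_insert hn, add_comm, ← e1]
      by_contra! hlt
      exact hcon α ⟨e1 ▸ h1, hlt⟩
  have := key _ le_rfl
  simp only [Fin.is_lt, Finset.filter_true] at this
  linarith [hx.2]

end Intervals

namespace AIET

variable {A : Type*} [Fintype A]

/-- The domain `[0, |η|)`. -/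
abbrev Domain (T : AIET A) : Type := Set.Ico (0 : ℝ) T.total

/-- An interval exchange transformation is one with all slopes equal to `1`. -/
def IsIET (T : AIET A) : Prop := T.logSlope = 0

lemma imageLen_pos (T : AIET A) (α : A) : 0 < T.imageLen α :=
  mul_pos (Real.exp_pos _) (T.len_pos α)

lemma sum_imageLen (T : AIET A) : ∑ α, T.imageLen α = T.total := by
  rw [ExchangeData.total, ← T.balance]
  exact Finset.sum_congr rfl fun α _ => mul_comm _ _

lemma map_eq (T : AIET A) {x : ℝ} {α : A} (h : x ∈ T.interval α) :
    T.map x = ExchangeData.leftEnd T.perm.bot T.imageLen α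
      + Real.exp (T.logSlope α) * (x - ExchangeData.leftEnd T.perm.top T.len α) := by
  unfold ExchangeData.map
  rw [Finset.sum_eq_single α]
  · rw [if_pos h]
  · intro β _ hβ
    exact if_neg fun h' => hβ (ExchangeData.eq_of_mem_of_mem T.perm.top T.len_pos h' h)
  · simp

lemma map_mem (T : AIET A) {x : ℝ} {α : A} (h : x ∈ T.interval α) :
    T.map x ∈ Set.Ico (ExchangeData.leftEnd T.perm.bot T.imageLen α)
      (ExchangeData.leftEnd T.perm.bot T.imageLen α + T.imageLen α) := by
  rw [T.map_eq h]
  have he := Real.exp_pos (T.logSlope α)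
  have h1 := mul_nonneg he.le (sub_nonneg.mpr h.1)
  have h2 := mul_lt_mul_of_pos_left (sub_lt_iff_lt_add'.mpr h.2) he
  refine ⟨by linarith, ?_⟩
  unfold ExchangeData.imageLen at *
  linarith

lemma map_bijOn (T : AIET A) :
    Set.BijOn T.map (Set.Ico 0 T.total) (Set.Ico 0 T.total) := by
  refine ⟨?_, ?_, ?_⟩
  · intro x hx
    obtain ⟨α, hα⟩ := ExchangeData.exists_mem_Ico T.perm.top hx
    have h := T.map_mem hα
    have h1 := ExchangeData.leftEnd_nonneg T.perm.bot T.imageLen_pos α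
    have h2 := ExchangeData.leftEnd_add_le_sum T.perm.bot T.imageLen_pos α
    rw [T.sum_imageLen] at h2
    exact ⟨h1.trans h.1, h.2.trans_le h2⟩
  · intro x hx y hy hxy
    obtain ⟨α, hα⟩ := ExchangeData.exists_mem_Ico T.perm.top hx
    obtain ⟨β, hβ⟩ := ExchangeData.exists_mem_Ico T.perm.top hy
    have h : α = β := ExchangeData.eq_of_mem_of_mem T.perm.bot T.imageLen_pos
      (T.map_mem hα) (hxy ▸ T.map_mem hβ)
    subst h
    rw [T.map_eq hα, T.map_eq hβ] at hxy
    have := mul_left_cancel₀ (Real.exp_pos (T.logSlope α)).ne' (add_left_cancel hxy)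
    linarith
  · intro y hy
    rw [← T.sum_imageLen] at hy
    obtain ⟨α, hα⟩ := ExchangeData.exists_mem_Ico T.perm.bot hy
    set x := ExchangeData.leftEnd T.perm.top T.len α
      + Real.exp (-T.logSlope α) * (y - ExchangeData.leftEnd T.perm.bot T.imageLen α) with hx
    have he := Real.exp_pos (-T.logSlope α)
    have hee : Real.exp (-T.logSlope α) * Real.exp (T.logSlope α) = 1 := by
      rw [← Real.exp_add]; simp
    have hmem : x ∈ T.interval α := by
      have h1 := mul_nonneg he.le (sub_nonneg.mpr hα.1)
      have h2 := mul_lt_mul_of_pos_left (sub_lt_iff_lt_add'.mpr hα.2) he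
      unfold ExchangeData.imageLen at h2
      rw [← mul_assoc, hee, one_mul] at h2
      exact ⟨by rw [hx]; unfold ExchangeData.imageLen; unfold ExchangeData.imageLen at h1; linarith,
        by rw [hx]; unfold ExchangeData.imageLen; linarith⟩
    refine ⟨x, ⟨?_, ?_⟩, ?_⟩
    · exact (ExchangeData.leftEnd_nonneg T.perm.top T.len_pos α).trans hmem.1
    · exact hmem.2.trans_le (ExchangeData.leftEnd_add_le_sum T.perm.top T.len_pos α)
    · rw [T.map_eq hmem, hx, add_sub_cancel_left, ← mul_assoc, mul_comm (Real.exp (T.logSlope α)),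
        hee]
      ring

/-- The transformation as a bijection of its domain. -/
def toPerm (T : AIET A) : Equiv.Perm T.Domain := T.map_bijOn.equiv T.map

variable [DecidableEq A] [Nontrivial A]

/-- `Aff(γ, ω)`: the AIETs of the unit interval with log-slope vector `ω` and combinatorial
rotation number `γ`. -/
def Aff (γ : RauzyPath A) (ω : A → ℝ) : Set (AIET A) :=
  {T | T.total = 1 ∧ T.logSlope = ω ∧ T.InfinitelyRenormalizable ∧ T.rotationNumber = γ}

end AIET

/-- The Birkhoff sums `S_n f` over an invertible map, for `n ∈ ℤ`: the additive cocycle with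
`S_n f = f + f ∘ T + ⋯ + f ∘ T^{n-1}` for `n ≥ 0`
and `S_n f = -(f ∘ T^n + ⋯ + f ∘ T^{-1})` for `n < 0`. -/
def zBirkhoffSum {X : Type*} (T : Equiv.Perm X) (f : X → ℝ) (n : ℤ) (x : X) : ℝ :=
  if 0 ≤ n then ∑ j ∈ Finset.Ico 0 n, f ((T ^ j) x) else -∑ j ∈ Finset.Ico n 0, f ((T ^ j) x)

end

/-!
Let `T⁽ⁿ⁾` be the `n`-th step of the Rauzy-Veech induction of `T`. It is a first return map, and
over its interval `I⁽ⁿ⁾_α` stands a Rokhlin tower on whose floors `T` acts affinely. The itinerary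
of a point that climbs this tower is a word `D.word n α` in the letters, which depends on `n` and
`α` only (`AIET.follows_word`), and the towers cover the domain (`AIET.exists_word_cover`). The
number of occurrences of `β` in the word is the entry `(α, β)` of the height cocycle
(`ExchangeData.count_word`), so that the log-slopes of `T⁽ⁿ⁾` are the Birkhoff sums of those of
`T` over the towers, and form the vector `Q_{0,n} ω`. The cocycle only depends on the rotation
number, so it is the one of `T₀`; for `ω ∈ E_cs` and `n = n_k` the vector is bounded uniformly in
`k`.

Given `x`, let `y ∈ I⁽ⁿ⁾_α` be the base point of the floor on which `x` lies, `n = n_k`. The block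
`Q_{n_k, n_k + N}` is positive and bounded, so the orbit of `y` under `T⁽ⁿ⁾` visits `I⁽ⁿ⁾_α`
again, at a point `y'`, within a number of steps that does not depend on `k`, both in the future
and in the past (`AIET.exists_return`). Move this loop up to the floor of `x`: the point `x'`
above `y'` is on the orbit of `x`, and since the itineraries from `y` to `x` and from `y'` to `x'`
are equal, the Birkhoff sum from `x` to `x'` equals the one from `y` to `y'` (`AIET.follows_conj`,
`AIET.sum_map_conj`). The latter is a sum of boundedly many bounded log-slopes of `T⁽ⁿ⁾`. Finally
the time from `x` to `x'` is at least the height of the tower, and the heights tend to infinity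
because each positive block at least doubles the smallest of them
(`ExchangeData.exists_forall_le_length_word`).
-/

/-! ### The combinatorics of a Rauzy move -/

namespace PermPair

variable {A : Type*} [Fintype A]

lemma irreducible_iff (π : PermPair A) : π.Irreducible ↔
    ∀ k : ℕ, 1 ≤ k → k ≤ Fintype.card A →
      (∀ α, (π.top α : ℕ) < k ↔ (π.bot α : ℕ) < k) → k = Fintype.card A := by
  have key : ∀ k : ℕ, ((fun i => π.bot (π.top.symm i)) '' {i | (i : ℕ) < k} =
      {i : Fin (Fintype.card A) | (i : ℕ) < k}) ↔
      ∀ α, (π.top α : ℕ) < k ↔ (π.bot α : ℕ) < k := by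
    intro k
    rw [Set.ext_iff]
    constructor
    · intro h α
      have := h (π.bot α)
      simp only [Set.mem_image, Set.mem_ofPred_eq, EmbeddingLike.apply_eq_iff_eq] at this
      rw [← this]
      constructor
      · intro hα
        exact ⟨π.top α, hα, by simp⟩
      · rintro ⟨i, hi, rfl⟩
        simpa using hi
    · intro h i
      simp only [Set.mem_image, Set.mem_ofPred_eq]
      constructor
      · rintro ⟨j, hj, rfl⟩
        rw [← h]
        simpa using hj
      · intro hi
        refine ⟨π.top (π.bot.symm i), ?_, by simp⟩
        rw [h]
        simpa using hi
  unfold Irreducible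
  simp only [key]

variable [Nontrivial A]

lemma val_le_lastPos (q : Fin (Fintype.card A)) : q ≤ lastPos A := by
  have := q.2
  rw [Fin.le_def]
  simp only [lastPos]
  omega

lemma moveLastAfter_of_le {p q : Fin (Fintype.card A)} (h : q ≤ p) :
    moveLastAfter p q = q := by
  unfold moveLastAfter
  split_ifs with hp
  · refine Fin.cycleIcc_of_lt ?_
    rw [Fin.lt_def]
    rw [Fin.le_def] at h
    simp only
    omega
  · rfl

lemma val_moveLastAfter_of_lt_of_lt {p q : Fin (Fintype.card A)} (h : p < q)
    (hq : q < lastPos A) : (moveLastAfter p q : ℕ) = q + 1 := by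
  have : NeZero (Fintype.card A) := ⟨Fintype.card_ne_zero⟩
  rw [Fin.lt_def] at h hq
  have hl : (lastPos A : ℕ) = Fintype.card A - 1 := rfl
  have hp : (p : ℕ) + 1 < Fintype.card A := by omega
  unfold moveLastAfter
  rw [dif_pos hp, Fin.cycleIcc_of_ge_of_lt (by rw [Fin.le_def]; simp only; omega)
    (by rw [Fin.lt_def]; omega)]
  rw [Fin.val_add, Fin.val_one', Nat.add_mod_mod, Nat.mod_eq_of_lt (by omega)]

lemma val_moveLastAfter_last {p : Fin (Fintype.card A)} (hp : p < lastPos A) :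
    (moveLastAfter p (lastPos A) : ℕ) = p + 1 := by
  have : NeZero (Fintype.card A) := ⟨Fintype.card_ne_zero⟩
  rw [Fin.lt_def] at hp
  have hl : (lastPos A : ℕ) = Fintype.card A - 1 := rfl
  have hp' : (p : ℕ) + 1 < Fintype.card A := by omega
  unfold moveLastAfter
  rw [dif_pos hp', Fin.cycleIcc_of_last (by rw [Fin.le_def]; simp only; omega)]

/-- A permutation by `moveLastAfter p` does not change which positions are below `k`, for
`k ≤ p`. -/
lemma val_moveLastAfter_lt_iff {p q : Fin (Fintype.card A)} {k : ℕ}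
    (hk : k ≤ (moveLastAfter p p : ℕ)) : (moveLastAfter p q : ℕ) < k ↔ (q : ℕ) < k := by
  rw [moveLastAfter_of_le le_rfl] at hk
  rcases le_or_gt q p with h | h
  · rw [moveLastAfter_of_le h]
  · have hm : p < moveLastAfter p q := by
      by_contra! hle
      have := (moveLastAfter p).injective (moveLastAfter_of_le hle)
      exact absurd (this ▸ hle) (not_le.mpr h)
    rw [Fin.lt_def] at h hm
    omega

lemma Irreducible.lastTop_ne_lastBot {π : PermPair A} (h : π.Irreducible) :
    π.lastTop ≠ π.lastBot := by
  intro he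
  rw [irreducible_iff] at h
  have hd : 1 < Fintype.card A := Fintype.one_lt_card
  have hl : (lastPos A : ℕ) = Fintype.card A - 1 := rfl
  have := h (Fintype.card A - 1) (by omega) (by omega) (fun α => by
    have h1 : π.top α = lastPos A ↔ π.bot α = lastPos A := by
      rw [← Equiv.eq_symm_apply, ← Equiv.eq_symm_apply]
      unfold lastTop lastBot at he
      rw [he]
    rw [Fin.ext_iff, Fin.ext_iff, hl] at h1
    have := (π.top α).2
    have := (π.bot α).2
    omega)
  omega

lemma Irreducible.winner_ne_loser {π : PermPair A} (h : π.Irreducible) (ε : Fin 2) :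
    π.winner ε ≠ π.loser ε := by
  unfold winner loser
  split_ifs
  · exact h.lastTop_ne_lastBot
  · exact h.lastTop_ne_lastBot.symm

@[simp] lemma top_lastTop (π : PermPair A) : π.top π.lastTop = lastPos A := by simp [lastTop]

@[simp] lemma bot_lastBot (π : PermPair A) : π.bot π.lastBot = lastPos A := by simp [lastBot]

lemma Irreducible.rauzyMove {π : PermPair A} (h : π.Irreducible) (ε : Fin 2) :
    (π.rauzyMove ε).Irreducible := by
  rw [irreducible_iff] at h ⊢
  intro k hk hkd hiff
  by_contra hne
  refine hne (h k hk hkd fun α => ?_)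
  have hl : (lastPos A : ℕ) = Fintype.card A - 1 := rfl
  unfold PermPair.rauzyMove winner at hiff
  -- The winner is in the last position of the unchanged order, so its position in the other order
  -- is at least `k`, and the move changes that order beyond the winner only.
  split_ifs at hiff with hε
  · have hw := hiff π.lastTop
    simp only [Equiv.trans_apply, top_lastTop, hl] at hw
    rw [hiff α, Equiv.trans_apply, val_moveLastAfter_lt_iff (by omega)]
  · have hw := hiff π.lastBot
    simp only [Equiv.trans_apply, bot_lastBot, hl] at hw
    rw [← hiff α, Equiv.trans_apply, val_moveLastAfter_lt_iff (by omega)]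

end PermPair

namespace ExchangeData

variable {A : Type*} [Fintype A]

/-! ### End points and lengths after a Rauzy move -/

lemma sum_eq_sum_add_of_eq_off_pair {f g : A → ℝ} {w l : A} (hwl : w ≠ l)
    (h : ∀ α, α ≠ w → α ≠ l → f α = g α) :
    ∑ α, f α = ∑ α, g α + ((f w - g w) + (f l - g l)) := by
  classical
  rw [← sub_eq_iff_eq_add', ← Finset.sum_sub_distrib]
  exact Fintype.sum_eq_add w l hwl fun α hα => sub_eq_zero.mpr (h α hα.1 hα.2)

/-- Cutting the last interval does not move any left end point. -/
lemma leftEnd_congr_of_last {σ : A ≃ Fin (Fintype.card A)} {ℓ ℓ' : A → ℝ} {w : A}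
    (hw : ∀ α, σ α ≤ σ w) (h : ∀ α, α ≠ w → ℓ' α = ℓ α) : leftEnd σ ℓ' = leftEnd σ ℓ := by
  funext α
  refine Finset.sum_congr rfl fun β hβ => h β ?_
  rintro rfl
  exact absurd (Finset.mem_filter.mp hβ).2 (not_lt.mpr (hw α))

variable [Nontrivial A]

section Insert

variable {σ : A ≃ Fin (Fintype.card A)} {ℓ ℓ' : A → ℝ} {w l : A}

lemma lt_lastPos_of_ne (hl : σ l = PermPair.lastPos A) {α : A} (h : α ≠ l) :
    σ α < PermPair.lastPos A :=
  lt_of_le_of_ne (PermPair.val_le_lastPos _) fun he => h (σ.injective (he.trans hl.symm))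

lemma insert_lt_iff (hl : σ l = PermPair.lastPos A) {α β : A} (hα : α ≠ l)
    (hβ : β ≠ l) : PermPair.moveLastAfter (σ w) (σ β) < PermPair.moveLastAfter (σ w) (σ α) ↔
      σ β < σ α := by
  have h1 := lt_lastPos_of_ne hl hα
  have h2 := lt_lastPos_of_ne hl hβ
  rcases le_or_gt (σ α) (σ w) with h3 | h3 <;> rcases le_or_gt (σ β) (σ w) with h4 | h4
  · rw [PermPair.moveLastAfter_of_le h3, PermPair.moveLastAfter_of_le h4]
  · have := PermPair.val_moveLastAfter_of_lt_of_lt h4 h2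
    rw [PermPair.moveLastAfter_of_le h3]
    simp only [Fin.lt_def, Fin.le_def] at *
    omega
  · have := PermPair.val_moveLastAfter_of_lt_of_lt h3 h1
    rw [PermPair.moveLastAfter_of_le h4]
    simp only [Fin.lt_def, Fin.le_def] at *
    omega
  · have := PermPair.val_moveLastAfter_of_lt_of_lt h4 h2
    have := PermPair.val_moveLastAfter_of_lt_of_lt h3 h1
    simp only [Fin.lt_def] at *
    omega

lemma insert_last_lt_iff (hl : σ l = PermPair.lastPos A) (hwl : w ≠ l) {α : A} (hα : α ≠ l) :
    PermPair.moveLastAfter (σ w) (σ l) < PermPair.moveLastAfter (σ w) (σ α) ↔ σ w < σ α := by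
  have h1 := lt_lastPos_of_ne hl hα
  have h2 := PermPair.val_moveLastAfter_last (lt_lastPos_of_ne hl hwl)
  rw [hl]
  rcases le_or_gt (σ α) (σ w) with h3 | h3
  · rw [PermPair.moveLastAfter_of_le h3]
    simp only [Fin.lt_def, Fin.le_def] at *
    omega
  · have := PermPair.val_moveLastAfter_of_lt_of_lt h3 h1
    simp only [Fin.lt_def] at *
    omega

lemma insert_lt_last_iff (hl : σ l = PermPair.lastPos A) (hwl : w ≠ l) {β : A} (hβ : β ≠ l) :
    PermPair.moveLastAfter (σ w) (σ β) < PermPair.moveLastAfter (σ w) (σ l) ↔ σ β ≤ σ w := by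
  rw [← not_iff_not, not_lt, not_le, ← insert_last_lt_iff hl hwl hβ, le_iff_lt_or_eq]
  have : PermPair.moveLastAfter (σ w) (σ l) ≠ PermPair.moveLastAfter (σ w) (σ β) := fun h =>
    hβ (σ.injective ((PermPair.moveLastAfter (σ w)).injective h)).symm
  simp [this]

/-- When the last letter `l` is moved to the place right after `w` and the length of `w` is shared
between `w` and `l`, the left end points of the letters other than `l` do not move. -/
lemma leftEnd_insert_of_ne (hl : σ l = PermPair.lastPos A) (hwl : w ≠ l)
    (h : ∀ α, α ≠ w → α ≠ l → ℓ' α = ℓ α) (hsum : ℓ' w + ℓ' l = ℓ w) {α : A} (hα : α ≠ l) :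
    leftEnd (σ.trans (PermPair.moveLastAfter (σ w))) ℓ' α = leftEnd σ ℓ α := by
  classical
  unfold leftEnd
  rw [Finset.sum_filter, Finset.sum_filter, sum_eq_sum_add_of_eq_off_pair hwl
    (g := fun β => if σ β < σ α then ℓ β else 0)]
  · have h1 : ¬ σ l < σ α := by
      rw [hl]; exact not_lt.mpr (PermPair.val_le_lastPos _)
    simp only [Equiv.trans_apply, insert_lt_iff hl hα hwl, insert_last_lt_iff hl hwl hα, if_neg h1]
    split_ifs
    · linarith
    · simp
  · intro β hβw hβl
    simp only [Equiv.trans_apply, insert_lt_iff hl hα hβl, h β hβw hβl]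

/-- When the last letter `l` is moved to the place right after `w` and the length of `w` is shared
between `w` and `l`, the interval of `l` becomes the right part of the former interval of `w`. -/
lemma leftEnd_insert_self (hl : σ l = PermPair.lastPos A) (hwl : w ≠ l)
    (h : ∀ α, α ≠ w → α ≠ l → ℓ' α = ℓ α) :
    leftEnd (σ.trans (PermPair.moveLastAfter (σ w))) ℓ' l = leftEnd σ ℓ w + ℓ' w := by
  classical
  unfold leftEnd
  rw [Finset.sum_filter, Finset.sum_filter, sum_eq_sum_add_of_eq_off_pair hwl
    (g := fun β => if σ β < σ w then ℓ β else 0)]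
  · have h1 : ¬ σ l < σ w := by
      rw [hl]; exact not_lt.mpr (PermPair.val_le_lastPos _)
    simp only [Equiv.trans_apply, insert_lt_last_iff hl hwl hwl, le_refl, lt_irrefl, if_neg h1,
      if_true, if_false]
    ring
  · intro β hβw hβl
    have : σ β ≠ σ w := fun h => hβw (σ.injective h)
    simp only [Equiv.trans_apply, insert_lt_last_iff hl hwl hβl, h β hβw hβl, this.le_iff_lt]

end Insert

lemma leftEnd_add_last {σ : A ≃ Fin (Fintype.card A)} {ℓ : A → ℝ} {l : A}
    (hl : σ l = PermPair.lastPos A) : leftEnd σ ℓ l + ℓ l = ∑ α, ℓ α := by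
  classical
  unfold leftEnd
  rw [← Finset.add_sum_erase _ _ (Finset.mem_univ l), add_comm]
  congr 2
  ext β
  simp only [Finset.mem_filter, Finset.mem_univ, true_and, Finset.mem_erase, and_true]
  constructor
  · rintro h rfl
    exact lt_irrefl _ h
  · intro h
    rw [hl]
    exact lt_lastPos_of_ne hl h

end ExchangeData

/-! ### The induction step of an affine interval exchange transformation -/

namespace AIET

variable {A : Type*} [Fintype A]

lemma exp_neg_mul_imageLen (T : AIET A) (α : A) :
    Real.exp (-T.logSlope α) * T.imageLen α = T.len α := by
  rw [ExchangeData.imageLen, ← mul_assoc, ← Real.exp_add]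
  simp

variable [Nontrivial A]

lemma winner_ne_loser (T : AIET A) : T.winner ≠ T.loser :=
  T.irreducible.winner_ne_loser _

lemma winner_of_type_eq {T : AIET A} (h : T.type = 0) : T.winner = T.perm.lastTop := by
  simp [ExchangeData.winner, PermPair.winner, h]

lemma loser_of_type_eq {T : AIET A} (h : T.type = 0) : T.loser = T.perm.lastBot := by
  simp [ExchangeData.loser, PermPair.loser, h]

lemma winner_of_type_ne {T : AIET A} (h : T.type ≠ 0) : T.winner = T.perm.lastBot := by
  simp [ExchangeData.winner, PermPair.winner, h]

lemma loser_of_type_ne {T : AIET A} (h : T.type ≠ 0) : T.loser = T.perm.lastTop := by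
  simp [ExchangeData.loser, PermPair.loser, h]

lemma imageLen_loser_lt {T : AIET A} (h : T.type = 0) : T.imageLen T.loser < T.len T.winner := by
  rw [loser_of_type_eq h, winner_of_type_eq h]
  unfold ExchangeData.type at h
  by_contra hlt
  simp [hlt] at h

lemma len_loser_lt {T : AIET A} (ht : ¬ T.Tie) (h : T.type ≠ 0) :
    T.len T.loser < T.imageLen T.winner := by
  rw [loser_of_type_ne h, winner_of_type_ne h]
  unfold ExchangeData.type at h
  refine lt_of_le_of_ne (not_lt.mp fun hlt => h (if_pos hlt)) ht

lemma top_winner_of_type_eq {T : AIET A} (h : T.type = 0) :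
    T.perm.top T.winner = PermPair.lastPos A := by
  rw [winner_of_type_eq h, PermPair.top_lastTop]

lemma bot_loser_of_type_eq {T : AIET A} (h : T.type = 0) :
    T.perm.bot T.loser = PermPair.lastPos A := by
  rw [loser_of_type_eq h, PermPair.bot_lastBot]

lemma bot_winner_of_type_ne {T : AIET A} (h : T.type ≠ 0) :
    T.perm.bot T.winner = PermPair.lastPos A := by
  rw [winner_of_type_ne h, PermPair.bot_lastBot]

lemma top_loser_of_type_ne {T : AIET A} (h : T.type ≠ 0) :
    T.perm.top T.loser = PermPair.lastPos A := by
  rw [loser_of_type_ne h, PermPair.top_lastTop]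

lemma leftEnd_top_add_len_of_last {T : AIET A} {α : A}
    (h : T.perm.top α = PermPair.lastPos A) :
    ExchangeData.leftEnd T.perm.top T.len α + T.len α = T.total :=
  ExchangeData.leftEnd_add_last h

lemma leftEnd_bot_add_imageLen_of_last {T : AIET A} {α : A}
    (h : T.perm.bot α = PermPair.lastPos A) :
    ExchangeData.leftEnd T.perm.bot T.imageLen α + T.imageLen α = T.total := by
  rw [ExchangeData.leftEnd_add_last h, T.sum_imageLen]

variable [DecidableEq A]

section Step

variable (T : AIET A)

lemma rauzy_len_of_ne {α : A} (hw : α ≠ T.winner) (hl : α ≠ T.loser) :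
    T.rauzy.len α = T.len α := by
  simp [ExchangeData.rauzy, hw, hl]

lemma rauzy_logSlope_of_ne {α : A} (hl : α ≠ T.loser) : T.rauzy.logSlope α = T.logSlope α := by
  simp [ExchangeData.rauzy, hl]

lemma rauzy_logSlope_loser :
    T.rauzy.logSlope T.loser = T.logSlope T.loser + T.logSlope T.winner := by
  simp [ExchangeData.rauzy]

lemma rauzy_imageLen_of_ne {α : A} (hw : α ≠ T.winner) (hl : α ≠ T.loser) :
    T.rauzy.imageLen α = T.imageLen α := by
  rw [ExchangeData.imageLen, rauzy_len_of_ne T hw hl, rauzy_logSlope_of_ne T hl,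
    ExchangeData.imageLen]

variable {T}

lemma rauzy_len_winner_of_type_eq (h : T.type = 0) :
    T.rauzy.len T.winner = T.len T.winner - T.imageLen T.loser := by
  simp [ExchangeData.rauzy, h]

lemma rauzy_len_loser_of_type_eq (h : T.type = 0) : T.rauzy.len T.loser = T.len T.loser := by
  simp [ExchangeData.rauzy, h, T.winner_ne_loser.symm]

lemma rauzy_len_winner_of_type_ne (h : T.type ≠ 0) :
    T.rauzy.len T.winner =
      T.len T.winner - Real.exp (-T.logSlope T.winner) * T.len T.loser := by
  simp [ExchangeData.rauzy, h]

lemma rauzy_len_loser_of_type_ne (h : T.type ≠ 0) :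
    T.rauzy.len T.loser = Real.exp (-T.logSlope T.winner) * T.len T.loser := by
  simp [ExchangeData.rauzy, h, T.winner_ne_loser.symm]

lemma rauzy_imageLen_winner_of_type_eq (h : T.type = 0) :
    T.rauzy.imageLen T.winner =
      T.imageLen T.winner - Real.exp (T.logSlope T.winner) * T.imageLen T.loser := by
  rw [ExchangeData.imageLen, rauzy_len_winner_of_type_eq h,
    rauzy_logSlope_of_ne T T.winner_ne_loser, mul_sub]
  rfl

lemma rauzy_imageLen_loser_of_type_eq (h : T.type = 0) :
    T.rauzy.imageLen T.loser = Real.exp (T.logSlope T.winner) * T.imageLen T.loser := by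
  rw [ExchangeData.imageLen, rauzy_len_loser_of_type_eq h, rauzy_logSlope_loser, Real.exp_add,
    ExchangeData.imageLen]
  ring

lemma rauzy_imageLen_winner_of_type_ne (h : T.type ≠ 0) :
    T.rauzy.imageLen T.winner = T.imageLen T.winner - T.len T.loser := by
  rw [ExchangeData.imageLen, rauzy_len_winner_of_type_ne h,
    rauzy_logSlope_of_ne T T.winner_ne_loser, ExchangeData.imageLen, mul_sub, ← mul_assoc,
    ← Real.exp_add]
  simp

lemma rauzy_imageLen_loser_of_type_ne (h : T.type ≠ 0) :
    T.rauzy.imageLen T.loser = T.imageLen T.loser := by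
  rw [ExchangeData.imageLen, rauzy_len_loser_of_type_ne h, rauzy_logSlope_loser, ← mul_assoc,
    ← Real.exp_add, ExchangeData.imageLen]
  simp

lemma rauzy_top_of_type_eq (h : T.type = 0) : T.rauzy.perm.top = T.perm.top := by
  simp [ExchangeData.rauzy, PermPair.rauzyMove, h]

lemma rauzy_bot_of_type_eq (h : T.type = 0) : T.rauzy.perm.bot =
    T.perm.bot.trans (PermPair.moveLastAfter (T.perm.bot T.winner)) := by
  simp [ExchangeData.rauzy, PermPair.rauzyMove, ExchangeData.winner, h]

lemma rauzy_top_of_type_ne (h : T.type ≠ 0) : T.rauzy.perm.top =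
    T.perm.top.trans (PermPair.moveLastAfter (T.perm.top T.winner)) := by
  simp [ExchangeData.rauzy, PermPair.rauzyMove, ExchangeData.winner, h]

lemma rauzy_bot_of_type_ne (h : T.type ≠ 0) : T.rauzy.perm.bot = T.perm.bot := by
  simp [ExchangeData.rauzy, PermPair.rauzyMove, h]

/-- The parameters of the Rauzy-Veech induction step are again those of an affine interval exchange
transformation. -/
noncomputable def rauzyStep (T : AIET A) (ht : ¬ T.Tie) : AIET A where
  toExchangeData := T.rauzy
  irreducible := T.irreducible.rauzyMove _
  len_pos α := by
    by_cases hw : α = T.winner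
    · subst hw
      by_cases h : T.type = 0
      · rw [rauzy_len_winner_of_type_eq h]
        exact sub_pos.mpr (imageLen_loser_lt h)
      · rw [rauzy_len_winner_of_type_ne h, sub_pos, ← T.exp_neg_mul_imageLen T.winner]
        exact mul_lt_mul_of_pos_left (len_loser_lt ht h) (Real.exp_pos _)
    by_cases hl : α = T.loser
    · subst hl
      by_cases h : T.type = 0
      · rw [rauzy_len_loser_of_type_eq h]
        exact T.len_pos _
      · rw [rauzy_len_loser_of_type_ne h]
        exact mul_pos (Real.exp_pos _) (T.len_pos _)
    rw [T.rauzy_len_of_ne hw hl]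
    exact T.len_pos α
  balance := by
    have e : ∑ α, T.rauzy.len α * Real.exp (T.rauzy.logSlope α) = ∑ α, T.rauzy.imageLen α :=
      Finset.sum_congr rfl fun α _ => mul_comm _ _
    rw [e, ExchangeData.sum_eq_sum_add_of_eq_off_pair T.winner_ne_loser
      (fun α => T.rauzy_imageLen_of_ne), ExchangeData.sum_eq_sum_add_of_eq_off_pair
      T.winner_ne_loser (fun α => T.rauzy_len_of_ne), T.sum_imageLen, ExchangeData.total]
    by_cases h : T.type = 0
    · rw [rauzy_imageLen_winner_of_type_eq h, rauzy_imageLen_loser_of_type_eq h,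
        rauzy_len_winner_of_type_eq h, rauzy_len_loser_of_type_eq h]
      ring
    · rw [rauzy_imageLen_winner_of_type_ne h, rauzy_imageLen_loser_of_type_ne h,
        rauzy_len_winner_of_type_ne h, rauzy_len_loser_of_type_ne h]
      ring

end Step

end AIET

/-! ### Itineraries -/

namespace ExchangeData

variable {A : Type*} [Fintype A]

/-- `D.Follows w x y` means that the orbit of `x` visits successively the intervals with the letters
of the word `w`, and then arrives at `y`. -/
def Follows (D : ExchangeData A) : List A → ℝ → ℝ → Prop
  | [], x, y => x = y
  | a :: w, x, y => x ∈ D.interval a ∧ D.Follows w (D.map x) y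

variable {D : ExchangeData A}

lemma follows_append {u v : List A} {x z : ℝ} :
    D.Follows (u ++ v) x z ↔ ∃ y, D.Follows u x y ∧ D.Follows v y z := by
  induction u generalizing x with
  | nil => simp [Follows]
  | cons a u ih => simp [Follows, ih, and_assoc]

lemma Follows.append {u v : List A} {x y z : ℝ} (h : D.Follows u x y) (h' : D.Follows v y z) :
    D.Follows (u ++ v) x z :=
  follows_append.mpr ⟨y, h, h'⟩

lemma Follows.eq_iterate {w : List A} {x y : ℝ} (h : D.Follows w x y) :
    D.map^[w.length] x = y := by
  induction w generalizing x with
  | nil => exact h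
  | cons a w ih => exact ih h.2

lemma Follows.of_append {u v : List A} {x y z : ℝ} (h : D.Follows (u ++ v) x z)
    (h' : D.Follows u x y) : D.Follows v y z := by
  obtain ⟨y', hu, hv⟩ := follows_append.mp h
  rwa [← h'.eq_iterate, hu.eq_iterate]

lemma Follows.of_append_left {u v : List A} {x z : ℝ} (h : D.Follows (u ++ v) x z) :
    ∃ y, D.Follows u x y := by
  obtain ⟨y, hu, -⟩ := follows_append.mp h
  exact ⟨y, hu⟩

variable [Nontrivial A] [DecidableEq A]

/-- The word that describes, in terms of the intervals of `D`, one step of the orbit of a point of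
the interval of `α` after Rauzy-Veech induction. -/
noncomputable def rauzyWord (D : ExchangeData A) (α : A) : List A :=
  if α = D.loser then if D.type = 0 then [D.loser, D.winner] else [D.winner, D.loser] else [α]

end ExchangeData

/-! ### One induction step as a first return map -/

namespace AIET

variable {A : Type*} [Fintype A]

lemma mem_Ico_of_mem_interval (T : AIET A) {x : ℝ} {α : A} (h : x ∈ T.interval α) :
    x ∈ Set.Ico 0 T.total :=
  ⟨(ExchangeData.leftEnd_nonneg _ T.len_pos α).trans h.1,
    h.2.trans_le (ExchangeData.leftEnd_add_le_sum _ T.len_pos α)⟩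

lemma eq_of_mem_interval (T : AIET A) {x : ℝ} {α β : A} (hα : x ∈ T.interval α)
    (hβ : x ∈ T.interval β) : α = β :=
  ExchangeData.eq_of_mem_of_mem T.perm.top T.len_pos hα hβ

variable [Nontrivial A] [DecidableEq A]

section Step

variable {T : AIET A}

lemma rauzy_leftEnd_top_of_type_eq (h : T.type = 0) (α : A) :
    ExchangeData.leftEnd T.rauzy.perm.top T.rauzy.len α =
      ExchangeData.leftEnd T.perm.top T.len α := by
  rw [rauzy_top_of_type_eq h, ExchangeData.leftEnd_congr_of_last (w := T.winner)]
  · intro β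
    rw [top_winner_of_type_eq h]
    exact PermPair.val_le_lastPos _
  · intro β hβ
    by_cases hl : β = T.loser
    · rw [hl, rauzy_len_loser_of_type_eq h]
    · exact T.rauzy_len_of_ne hβ hl

lemma rauzy_leftEnd_bot_of_type_eq (h : T.type = 0) {α : A} (hα : α ≠ T.loser) :
    ExchangeData.leftEnd T.rauzy.perm.bot T.rauzy.imageLen α =
      ExchangeData.leftEnd T.perm.bot T.imageLen α := by
  rw [rauzy_bot_of_type_eq h]
  refine ExchangeData.leftEnd_insert_of_ne (bot_loser_of_type_eq h) T.winner_ne_loser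
    (fun α => T.rauzy_imageLen_of_ne) ?_ hα
  rw [rauzy_imageLen_winner_of_type_eq h, rauzy_imageLen_loser_of_type_eq h, sub_add_cancel]

lemma rauzy_leftEnd_bot_loser_of_type_eq (h : T.type = 0) :
    ExchangeData.leftEnd T.rauzy.perm.bot T.rauzy.imageLen T.loser =
      ExchangeData.leftEnd T.perm.bot T.imageLen T.winner + T.rauzy.imageLen T.winner := by
  rw [rauzy_bot_of_type_eq h]
  exact ExchangeData.leftEnd_insert_self (bot_loser_of_type_eq h) T.winner_ne_loser
    (fun α => T.rauzy_imageLen_of_ne)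

lemma rauzy_leftEnd_bot_of_type_ne (h : T.type ≠ 0) (α : A) :
    ExchangeData.leftEnd T.rauzy.perm.bot T.rauzy.imageLen α =
      ExchangeData.leftEnd T.perm.bot T.imageLen α := by
  rw [rauzy_bot_of_type_ne h, ExchangeData.leftEnd_congr_of_last (w := T.winner)]
  · intro β
    rw [bot_winner_of_type_ne h]
    exact PermPair.val_le_lastPos _
  · intro β hβ
    by_cases hl : β = T.loser
    · rw [hl, rauzy_imageLen_loser_of_type_ne h]
    · exact T.rauzy_imageLen_of_ne hβ hl

lemma rauzy_leftEnd_top_of_type_ne (h : T.type ≠ 0) {α : A} (hα : α ≠ T.loser) :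
    ExchangeData.leftEnd T.rauzy.perm.top T.rauzy.len α =
      ExchangeData.leftEnd T.perm.top T.len α := by
  rw [rauzy_top_of_type_ne h]
  refine ExchangeData.leftEnd_insert_of_ne (top_loser_of_type_ne h) T.winner_ne_loser
    (fun α => T.rauzy_len_of_ne) ?_ hα
  rw [rauzy_len_winner_of_type_ne h, rauzy_len_loser_of_type_ne h, sub_add_cancel]

lemma rauzy_leftEnd_top_loser_of_type_ne (h : T.type ≠ 0) :
    ExchangeData.leftEnd T.rauzy.perm.top T.rauzy.len T.loser =
      ExchangeData.leftEnd T.perm.top T.len T.winner + T.rauzy.len T.winner := by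
  rw [rauzy_top_of_type_ne h]
  exact ExchangeData.leftEnd_insert_self (top_loser_of_type_ne h) T.winner_ne_loser
    (fun α => T.rauzy_len_of_ne)

lemma rauzy_total_of_type_eq (h : T.type = 0) :
    T.rauzy.total = T.total - T.imageLen T.loser := by
  rw [ExchangeData.total, ExchangeData.sum_eq_sum_add_of_eq_off_pair T.winner_ne_loser
    (fun α => T.rauzy_len_of_ne), rauzy_len_winner_of_type_eq h, rauzy_len_loser_of_type_eq h,
    ExchangeData.total]
  ring

lemma rauzy_total_of_type_ne (h : T.type ≠ 0) : T.rauzy.total = T.total - T.len T.loser := by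
  rw [ExchangeData.total, ExchangeData.sum_eq_sum_add_of_eq_off_pair T.winner_ne_loser
    (fun α => T.rauzy_len_of_ne), rauzy_len_winner_of_type_ne h, rauzy_len_loser_of_type_ne h,
    ExchangeData.total]
  ring

lemma follows_rauzyWord_of_ne (ht : ¬ T.Tie) {α : A} (hα : α ≠ T.loser) {x : ℝ}
    (hx : x ∈ T.rauzy.interval α) : T.Follows (T.rauzyWord α) x (T.rauzy.map x) := by
  have hmap := (T.rauzyStep ht).map_eq hx
  have htop : ExchangeData.leftEnd T.rauzy.perm.top T.rauzy.len α =
      ExchangeData.leftEnd T.perm.top T.len α := by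
    by_cases h : T.type = 0
    · exact rauzy_leftEnd_top_of_type_eq h α
    · exact rauzy_leftEnd_top_of_type_ne h hα
  have hbot : ExchangeData.leftEnd T.rauzy.perm.bot T.rauzy.imageLen α =
      ExchangeData.leftEnd T.perm.bot T.imageLen α := by
    by_cases h : T.type = 0
    · exact rauzy_leftEnd_bot_of_type_eq h hα
    · exact rauzy_leftEnd_bot_of_type_ne h α
  have hlen : T.rauzy.len α ≤ T.len α := by
    by_cases hw : α = T.winner
    · subst hw
      by_cases h : T.type = 0
      · rw [rauzy_len_winner_of_type_eq h]
        linarith [T.imageLen_pos T.loser]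
      · rw [rauzy_len_winner_of_type_ne h]
        linarith [mul_pos (Real.exp_pos (-T.logSlope T.winner)) (T.len_pos T.loser)]
    · exact (T.rauzy_len_of_ne hw hα).le
  have hxα : x ∈ T.interval α := by
    have h1 := hx.1
    have h2 := hx.2
    rw [htop] at h1 h2
    exact ⟨h1, by linarith⟩
  rw [ExchangeData.rauzyWord, if_neg hα]
  refine ⟨hxα, ?_⟩
  change T.map x = (T.rauzyStep ht).map x
  rw [hmap, T.map_eq hxα]
  simp only [rauzyStep]
  rw [htop, hbot, T.rauzy_logSlope_of_ne hα]

lemma follows_rauzyWord_loser_of_type_eq (ht : ¬ T.Tie) (h : T.type = 0) {x : ℝ}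
    (hx : x ∈ T.rauzy.interval T.loser) :
    T.Follows [T.loser, T.winner] x (T.rauzy.map x) := by
  have hmap : T.rauzy.map x = _ := (T.rauzyStep ht).map_eq hx
  have hxl : x ∈ T.interval T.loser := by
    unfold ExchangeData.interval at hx ⊢
    rwa [rauzy_leftEnd_top_of_type_eq h, rauzy_len_loser_of_type_eq h] at hx
  have hTx := T.map_mem hxl
  have h1 := leftEnd_bot_add_imageLen_of_last (bot_loser_of_type_eq h)
  have h2 := leftEnd_top_add_len_of_last (top_winner_of_type_eq h)
  have h3 := imageLen_loser_lt h
  have hTxw : T.map x ∈ T.interval T.winner := ⟨by linarith [hTx.1], by linarith [hTx.2]⟩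
  refine ⟨hxl, hTxw, ?_⟩
  change T.map (T.map x) = _
  rw [hmap, T.map_eq hTxw, T.map_eq hxl]
  simp only [rauzyStep]
  rw [rauzy_leftEnd_bot_loser_of_type_eq h, rauzy_leftEnd_top_of_type_eq h, rauzy_logSlope_loser,
    rauzy_imageLen_winner_of_type_eq h, Real.exp_add]
  have e1 : T.imageLen T.winner = Real.exp (T.logSlope T.winner) * T.len T.winner := rfl
  rw [e1, eq_sub_of_add_eq h1, eq_sub_of_add_eq h2]
  ring

lemma follows_rauzyWord_loser_of_type_ne (ht : ¬ T.Tie) (h : T.type ≠ 0) {x : ℝ}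
    (hx : x ∈ T.rauzy.interval T.loser) :
    T.Follows [T.winner, T.loser] x (T.rauzy.map x) := by
  have hmap : T.rauzy.map x = _ := (T.rauzyStep ht).map_eq hx
  have hx1 := hx.1
  have hx2 := hx.2
  have hlw : T.rauzy.len T.winner + T.rauzy.len T.loser = T.len T.winner := by
    rw [rauzy_len_winner_of_type_ne h, rauzy_len_loser_of_type_ne h, sub_add_cancel]
  have hpos : 0 < T.rauzy.len T.winner := (T.rauzyStep ht).len_pos _
  rw [rauzy_leftEnd_top_loser_of_type_ne h] at hx1 hx2
  have hxw : x ∈ T.interval T.winner := ⟨by linarith, by linarith⟩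
  have hTx := T.map_mem hxw
  have h1 := leftEnd_bot_add_imageLen_of_last (bot_winner_of_type_ne h)
  have h2 := leftEnd_top_add_len_of_last (top_loser_of_type_ne h)
  -- The right part of the interval of the winner is sent onto the interval of the loser.
  have himg : Real.exp (T.logSlope T.winner) * T.rauzy.len T.winner =
      T.imageLen T.winner - T.len T.loser := by
    rw [← rauzy_imageLen_winner_of_type_ne h, ExchangeData.imageLen,
      rauzy_logSlope_of_ne T T.winner_ne_loser]
  have hTxl : T.map x ∈ T.interval T.loser := by
    refine ⟨?_, by linarith [hTx.2]⟩
    rw [T.map_eq hxw]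
    have := mul_le_mul_of_nonneg_left (le_sub_iff_add_le'.mpr hx1)
      (Real.exp_pos (T.logSlope T.winner)).le
    linarith
  refine ⟨hxw, hTxl, ?_⟩
  change T.map (T.map x) = _
  rw [hmap, T.map_eq hTxl, T.map_eq hxw]
  simp only [rauzyStep]
  rw [rauzy_leftEnd_bot_of_type_ne h, rauzy_leftEnd_top_loser_of_type_ne h, rauzy_logSlope_loser,
    Real.exp_add, eq_sub_of_add_eq h1, eq_sub_of_add_eq h2]
  linear_combination Real.exp (T.logSlope T.loser) * himg

/-- A step of Rauzy-Veech induction gives an induced map of `T`: its branches are the compositions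
of the branches of `T` along the words `rauzyWord`. -/
lemma follows_rauzyWord (ht : ¬ T.Tie) {α : A} {x : ℝ} (hx : x ∈ T.rauzy.interval α) :
    T.Follows (T.rauzyWord α) x (T.rauzy.map x) := by
  by_cases hα : α = T.loser
  · subst hα
    rw [ExchangeData.rauzyWord, if_pos rfl]
    split_ifs with h
    · exact follows_rauzyWord_loser_of_type_eq ht h hx
    · exact follows_rauzyWord_loser_of_type_ne ht h hx
  · exact follows_rauzyWord_of_ne ht hα hx

/-- Every point of the domain is on the orbit of a point of the new domain, before its return. -/
lemma exists_rauzyWord_cover (ht : ¬ T.Tie) {x : ℝ} (hx : x ∈ Set.Ico 0 T.total) :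
    ∃ (β : A) (y : ℝ) (u v : List A), y ∈ T.rauzy.interval β ∧ T.rauzyWord β = u ++ v ∧ v ≠ [] ∧
      T.Follows u y x := by
  by_cases hlt : x < T.rauzy.total
  · obtain ⟨β, hβ⟩ := ExchangeData.exists_mem_Ico (ℓ := T.rauzy.len) T.rauzy.perm.top ⟨hx.1, hlt⟩
    refine ⟨β, x, [], T.rauzyWord β, hβ, rfl, ?_, rfl⟩
    unfold ExchangeData.rauzyWord
    split_ifs <;> simp
  -- A point outside of the new domain is the image of a point of the new interval of the loser.
  rw [not_lt] at hlt
  obtain ⟨z, hz, rfl⟩ := T.map_bijOn.surjOn hx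
  obtain ⟨β, hβ⟩ := ExchangeData.exists_mem_Ico T.perm.top hz
  have hTz := T.map_mem hβ
  by_cases h : T.type = 0
  · have h1 := leftEnd_bot_add_imageLen_of_last (bot_loser_of_type_eq h)
    rw [rauzy_total_of_type_eq h] at hlt
    have hβl : β = T.loser := ExchangeData.eq_of_mem_of_mem T.perm.bot T.imageLen_pos hTz
      ⟨by linarith, by linarith [hx.2]⟩
    subst hβl
    refine ⟨T.loser, z, [T.loser], [T.winner], ?_, ?_, by simp, hβ, rfl⟩
    · unfold ExchangeData.interval
      rw [rauzy_leftEnd_top_of_type_eq h, rauzy_len_loser_of_type_eq h]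
      exact hβ
    · simp [ExchangeData.rauzyWord, h]
  · have h1 := leftEnd_bot_add_imageLen_of_last (bot_winner_of_type_ne h)
    have h2 := len_loser_lt ht h
    rw [rauzy_total_of_type_ne h] at hlt
    have hβw : β = T.winner := ExchangeData.eq_of_mem_of_mem T.perm.bot T.imageLen_pos hTz
      ⟨by linarith, by linarith [hx.2]⟩
    subst hβw
    refine ⟨T.loser, z, [T.winner], [T.loser], ?_, ?_, by simp, hβ, rfl⟩
    · have hlw : T.rauzy.len T.winner + T.rauzy.len T.loser = T.len T.winner := by
        rw [rauzy_len_winner_of_type_ne h, rauzy_len_loser_of_type_ne h, sub_add_cancel]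
      have himg : Real.exp (T.logSlope T.winner) * T.rauzy.len T.winner =
          T.imageLen T.winner - T.len T.loser := by
        rw [← rauzy_imageLen_winner_of_type_ne h, ExchangeData.imageLen,
          rauzy_logSlope_of_ne T T.winner_ne_loser]
      unfold ExchangeData.interval
      rw [rauzy_leftEnd_top_loser_of_type_ne h]
      refine ⟨?_, by linarith [hβ.2]⟩
      rw [T.map_eq hβ] at hlt
      have : Real.exp (T.logSlope T.winner) * T.rauzy.len T.winner ≤
          Real.exp (T.logSlope T.winner) *
            (z - ExchangeData.leftEnd T.perm.top T.len T.winner) := by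
        linarith
      linarith [le_of_mul_le_mul_left this (Real.exp_pos _)]
    · simp [ExchangeData.rauzyWord, h]

end Step

end AIET

/-! ### Words of several induction steps -/

lemma List.mul_length_le_length_flatMap {α β : Type*} {f : α → List β} {c : ℕ}
    (h : ∀ a, c ≤ (f a).length) (w : List α) : c * w.length ≤ (w.flatMap f).length := by
  induction w with
  | nil => simp
  | cons a w ih =>
    rw [List.flatMap_cons, List.length_append, List.length_cons, mul_add, mul_one, add_comm]
    exact add_le_add (h a) ih

lemma List.sum_map_flatMap {α β : Type*} {f : α → List β} {v : β → ℝ} {g : α → ℝ}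
    (h : ∀ a, ((f a).map v).sum = g a) (w : List α) :
    ((w.flatMap f).map v).sum = (w.map g).sum := by
  induction w with
  | nil => simp
  | cons a w ih => simp [List.flatMap_cons, ih, h]

lemma List.abs_sum_map_le {α : Type*} {g : α → ℝ} {C : ℝ} (h : ∀ a, |g a| ≤ C) (w : List α) :
    |(w.map g).sum| ≤ w.length * C := by
  induction w with
  | nil => simp
  | cons a w ih =>
    simp only [List.map_cons, List.sum_cons, List.length_cons, Nat.cast_add, Nat.cast_one]
    linarith [abs_add_le (g a) (w.map g).sum, h a]

lemma abs_le_l1Norm {A : Type*} [Fintype A] (v : A → ℝ) (α : A) : |v α| ≤ l1Norm v :=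
  Finset.single_le_sum (f := fun α => |v α|) (fun _ _ => abs_nonneg _) (Finset.mem_univ α)

namespace ExchangeData

variable {A : Type*} [Fintype A]

lemma Follows.flatMap {D D' : ExchangeData A} {f : A → List A}
    (h : ∀ α, ∀ x ∈ D'.interval α, D.Follows (f α) x (D'.map x)) {w : List A} {x y : ℝ}
    (hw : D'.Follows w x y) : D.Follows (w.flatMap f) x y := by
  induction w generalizing x with
  | nil => exact hw
  | cons a w ih => exact (h a x hw.1).append (ih hw.2)

variable [Nontrivial A] [DecidableEq A]

/-- The word that describes, in terms of the intervals of `D`, one step of the orbit of a point of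
the interval of `α` after `n` steps of Rauzy-Veech induction. -/
noncomputable def word (D : ExchangeData A) : ℕ → A → List A
  | 0, α => [α]
  | n + 1, α => ((rauzy^[n] D).rauzyWord α).flatMap (D.word n)

variable (D : ExchangeData A)

lemma word_add (n i : ℕ) (α : A) :
    D.word (n + i) α = ((rauzy^[n] D).word i α).flatMap (D.word n) := by
  induction i generalizing α with
  | zero => simp [word]
  | succ i ih =>
    rw [← add_assoc, word, word, List.flatMap_assoc, ← Function.iterate_add_apply, add_comm i n]
    congr 1
    funext β
    exact ih β

lemma one_le_length_word (n : ℕ) (α : A) : 1 ≤ (D.word n α).length := by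
  induction n generalizing α with
  | zero => simp [word]
  | succ n ih =>
    refine le_trans ?_ (List.mul_length_le_length_flatMap ih _)
    unfold rauzyWord
    split_ifs <;> simp

lemma rauzyMatrix_transpose_mul (M : Matrix A A ℤ) (α β : A) :
    (D.rauzyMatrix.transpose * M) α β = M α β + if α = D.loser then M D.winner β else 0 := by
  rw [rauzyMatrix, Matrix.transpose_add, Matrix.transpose_one, Matrix.transpose_single, add_mul,
    one_mul, Matrix.add_apply]
  split_ifs with h
  · subst h
    simp
  · rw [Matrix.single_mul_apply_of_ne _ _ _ _ _ h]

lemma count_word (n : ℕ) (α β : A) :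
    ((D.word n α).count β : ℤ) = D.heightCocycle 0 n α β := by
  induction n generalizing α with
  | zero => simp [word, heightCocycle, Matrix.one_apply, List.count_singleton]
  | succ n ih =>
    rw [heightCocycle, if_pos (Nat.zero_le n), rauzyMatrix_transpose_mul, ← ih, ← ih, word,
      rauzyWord]
    split_ifs with h1 h2
    · simp [h1]
    · simp [h1, add_comm]
    · simp

lemma sum_map_word (n : ℕ) (v : A → ℝ) (α : A) :
    ((D.word n α).map v).sum = intMulVec (D.heightCocycle 0 n) v α := by
  rw [Finset.sum_list_map_count, intMulVec, Matrix.mulVec, dotProduct]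
  rw [Finset.sum_subset (Finset.subset_univ _)]
  · refine Finset.sum_congr rfl fun β _ => ?_
    rw [Matrix.map_apply, ← count_word, nsmul_eq_mul, Int.cast_natCast]
  · intro β _ hβ
    rw [List.mem_toFinset, ← List.count_eq_zero] at hβ
    rw [hβ, zero_smul]

lemma length_word (n : ℕ) (α : A) :
    ((D.word n α).length : ℝ) = ∑ β, (D.heightCocycle 0 n α β : ℝ) := by
  have := D.sum_map_word n (fun _ => 1) α
  simpa [intMulVec, Matrix.mulVec, dotProduct] using this

lemma logSlope_iterate (n : ℕ) (α : A) :
    (rauzy^[n] D).logSlope α = ((D.word n α).map D.logSlope).sum := by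
  induction n generalizing α with
  | zero => simp [word]
  | succ n ih =>
    rw [word, List.sum_map_flatMap (fun β => (ih β).symm), Function.iterate_succ_apply', rauzyWord]
    simp only [rauzy]
    split_ifs with h1 h2
    · simp
    · simp [add_comm]
    · simp

lemma heightCocycle_add (m i : ℕ) :
    D.heightCocycle m (m + i) = (rauzy^[m] D).heightCocycle 0 i := by
  induction i with
  | zero =>
    cases m with
    | zero => rfl
    | succ m => simp [heightCocycle]
  | succ i ih =>
    rw [← add_assoc, heightCocycle, heightCocycle, if_pos (Nat.le_add_right m i),
      if_pos (Nat.zero_le i), ih, ← Function.iterate_add_apply, add_comm i m]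

lemma heightCocycle_congr {D D' : ExchangeData A} (h : D.rotationNumber = D'.rotationNumber)
    (m n : ℕ) : D.heightCocycle m n = D'.heightCocycle m n := by
  induction n with
  | zero => rfl
  | succ n ih =>
    have hn := congrFun h n
    simp only [rotationNumber, Prod.mk.injEq] at hn
    rw [heightCocycle, heightCocycle, ih, rauzyMatrix, rauzyMatrix, winner, winner, loser, loser,
      hn.1, hn.2]

/-- If blocks of the cocycle of a fixed length are positive arbitrarily late, all the return times
tend to infinity: every such block at least doubles the smallest one. -/
lemma exists_forall_le_length_word {n : ℕ → ℕ} (hn : StrictMono n) {N : ℕ}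
    (h : ∀ (k : ℕ) (α β : A), 1 ≤ D.heightCocycle (n k) (n k + N) α β) (c : ℕ) :
    ∃ n₀, ∀ m ≥ n₀, ∀ α, c ≤ (D.word m α).length := by
  suffices ∃ n₀, ∀ m ≥ n₀, ∀ α, 2 ^ c ≤ (D.word m α).length by
    obtain ⟨n₀, h₀⟩ := this
    exact ⟨n₀, fun m hm α => (Nat.lt_two_pow_self).le.trans (h₀ m hm α)⟩
  induction c with
  | zero => exact ⟨0, fun m _ α => by simpa using D.one_le_length_word m α⟩
  | succ c ih =>
    obtain ⟨n₀, h₀⟩ := ih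
    have h1 : ∀ α, 2 ^ (c + 1) ≤ (D.word (n n₀ + N) α).length := by
      intro α
      have h2 : 2 ≤ ((rauzy^[n n₀] D).word N α).length := by
        have hd : (2 : ℝ) ≤ Fintype.card A := by exact_mod_cast Fintype.one_lt_card (α := A)
        have : (Fintype.card A : ℝ) ≤ ((rauzy^[n n₀] D).word N α).length := by
          rw [length_word, ← heightCocycle_add]
          have := Finset.sum_le_sum (s := Finset.univ)
            (fun β _ => Int.cast_le (R := ℝ).mpr (h n₀ α β))
          simpa using this
        exact_mod_cast hd.trans this
      rw [word_add, pow_succ]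
      exact (Nat.mul_le_mul_left _ h2).trans
        (List.mul_length_le_length_flatMap (h₀ _ (hn.id_le n₀)) _)
    refine ⟨n n₀ + N, fun m hm α => ?_⟩
    obtain ⟨i, rfl⟩ := Nat.exists_eq_add_of_le hm
    rw [word_add]
    exact (Nat.le_mul_of_pos_right _ (one_le_length_word _ i α)).trans
      (List.mul_length_le_length_flatMap h1 _)

end ExchangeData

/-! ### Towers and returns -/

namespace AIET

variable {A : Type*} [Fintype A] [Nontrivial A] [DecidableEq A] {T : AIET A}

open ExchangeData (rauzy)

lemma exists_eq_rauzy_iterate (hT : T.InfinitelyRenormalizable) (n : ℕ) :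
    ∃ S : AIET A, S.toExchangeData = rauzy^[n] T.toExchangeData ∧ S.InfinitelyRenormalizable := by
  suffices ∃ S : AIET A, S.toExchangeData = rauzy^[n] T.toExchangeData by
    obtain ⟨S, hS⟩ := this
    refine ⟨S, hS, fun i => ?_⟩
    rw [hS, ← Function.iterate_add_apply]
    exact hT _
  induction n with
  | zero => exact ⟨T, rfl⟩
  | succ n ih =>
    obtain ⟨S, hS⟩ := ih
    refine ⟨S.rauzyStep ?_, ?_⟩
    · rw [hS]
      exact hT n
    · rw [Function.iterate_succ_apply']
      exact congrArg rauzy hS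

lemma follows_word (hT : T.InfinitelyRenormalizable) (n : ℕ) {α : A} {x : ℝ}
    (hx : x ∈ (rauzy^[n] T.toExchangeData).interval α) :
    T.Follows (T.word n α) x ((rauzy^[n] T.toExchangeData).map x) := by
  induction n generalizing α x with
  | zero => exact ⟨hx, rfl⟩
  | succ n ih =>
    obtain ⟨S, hS, -⟩ := exists_eq_rauzy_iterate hT n
    have ht : ¬ S.Tie := hS ▸ hT n
    rw [Function.iterate_succ_apply', ← hS] at hx ⊢
    rw [ExchangeData.word, ← hS]
    refine (follows_rauzyWord ht hx).flatMap fun β y hy => ?_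
    rw [hS] at hy ⊢
    exact ih hy

/-- The Rokhlin towers over the intervals of the `n`-th step of the induction cover the domain:
every point is on the orbit of some point `y` of such an interval, before the return of `y`. -/
lemma exists_word_cover (hT : T.InfinitelyRenormalizable) (n : ℕ) {x : ℝ}
    (hx : x ∈ Set.Ico 0 T.total) :
    ∃ (α : A) (y : ℝ) (u v : List A), y ∈ (rauzy^[n] T.toExchangeData).interval α ∧
      T.word n α = u ++ v ∧ v ≠ [] ∧ T.Follows u y x := by
  induction n with
  | zero =>
    obtain ⟨α, hα⟩ := ExchangeData.exists_mem_Ico T.perm.top hx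
    exact ⟨α, x, [], [α], hα, rfl, by simp, rfl⟩
  | succ n ih =>
    obtain ⟨α, y, u, v, hy, huv, hv, hu⟩ := ih
    obtain ⟨S, hS, -⟩ := exists_eq_rauzy_iterate hT n
    have ht : ¬ S.Tie := hS ▸ hT n
    rw [← hS] at hy
    obtain ⟨β, z, u', v', hz, huv', hv', hu'⟩ :=
      exists_rauzyWord_cover ht (S.mem_Ico_of_mem_interval hy)
    have hzy := follows_rauzyWord ht hz
    rw [huv'] at hzy
    obtain ⟨a, v'', rfl⟩ := List.exists_cons_of_ne_nil hv'
    have ha : a = α := S.eq_of_mem_interval (hzy.of_append hu').1 hy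
    subst ha
    refine ⟨β, z, u'.flatMap (T.word n) ++ u, v ++ v''.flatMap (T.word n), ?_, ?_, by simp [hv], ?_⟩
    · rwa [Function.iterate_succ_apply', ← hS]
    · rw [ExchangeData.word, ← hS, huv', List.flatMap_append, List.flatMap_cons, huv]
      simp
    · refine (hu'.flatMap fun γ p hp => ?_).append hu
      rw [hS] at hp ⊢
      exact follows_word hT n hp

/-- If the words of `N` steps of the induction contain all the letters, an orbit returns to each
interval of `T` within two such words. -/
lemma exists_return (hT : T.InfinitelyRenormalizable) {N R : ℕ}
    (hmem : ∀ α β, α ∈ T.word N β) (hlen : ∀ β, (T.word N β).length ≤ R) {α : A} {y : ℝ}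
    (hy : y ∈ T.interval α) :
    (∃ w y', y' ∈ T.interval α ∧ T.Follows (α :: w) y y' ∧ (α :: w).length ≤ 2 * R) ∧
      ∃ w y', y' ∈ T.interval α ∧ T.Follows (α :: w) y' y ∧ (α :: w).length ≤ 2 * R := by
  obtain ⟨β, z, u, v, hz, huv, hv, hu⟩ := exists_word_cover hT N (T.mem_Ico_of_mem_interval hy)
  obtain ⟨S, hS, -⟩ := exists_eq_rauzy_iterate hT N
  have hlβ := hlen β
  rw [huv, List.length_append] at hlβ
  constructor
  · -- Climb to the top of the tower of `y`, then climb the next tower up to the letter `α`.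
    have hzz := follows_word hT N hz
    rw [huv] at hzz
    have hvz := hzz.of_append hu
    have hz' : (rauzy^[N] T.toExchangeData).map z ∈ Set.Ico 0 S.total := by
      rw [← hS] at hz ⊢
      exact S.map_bijOn.mapsTo (S.mem_Ico_of_mem_interval hz)
    obtain ⟨β', hβ'⟩ := ExchangeData.exists_mem_Ico S.perm.top hz'
    change _ ∈ S.interval β' at hβ'
    rw [hS] at hβ'
    have hw := follows_word hT N hβ'
    obtain ⟨a, b, hab⟩ := List.append_of_mem (hmem α β')
    have hlβ' := hlen β'
    rw [hab, List.length_append, List.length_cons] at hlβ'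
    rw [hab, ExchangeData.follows_append] at hw
    obtain ⟨y', ha, hb⟩ := hw
    obtain ⟨c, v', rfl⟩ := List.exists_cons_of_ne_nil hv
    have hc : c = α := T.eq_of_mem_interval hvz.1 hy
    subst hc
    refine ⟨v' ++ a, y', hb.1, hvz.append ha, ?_⟩
    simp only [List.length_cons, List.length_append] at hlβ hlβ' ⊢
    omega
  · -- Go down to the base of the tower of `y`, then down the previous tower to the letter `α`.
    have hz' : z ∈ Set.Ico 0 S.total := S.mem_Ico_of_mem_interval (α := β) (by rwa [hS])
    obtain ⟨z₀, hz₀, hz₀z⟩ := S.map_bijOn.surjOn hz'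
    obtain ⟨β', hβ'⟩ := ExchangeData.exists_mem_Ico S.perm.top hz₀
    change _ ∈ S.interval β' at hβ'
    rw [hS] at hβ' hz₀z
    have hw := follows_word hT N hβ'
    obtain ⟨a, b, hab⟩ := List.append_of_mem (hmem α β')
    have hlβ' := hlen β'
    rw [hab, List.length_append, List.length_cons] at hlβ'
    rw [hab, ExchangeData.follows_append, hz₀z] at hw
    obtain ⟨y', ha, hb⟩ := hw
    refine ⟨b ++ u, y', hb.1, hb.append hu, ?_⟩
    simp only [List.length_cons, List.length_append] at hlβ hlβ' ⊢
    omega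

/-- A loop at the base of a tower can be moved to any floor of the tower. Its word is changed by a
cyclic permutation, as the part of the orbit between the base and the floor has the same word `u`
at the beginning and at the end of the loop. -/
lemma follows_conj (hT : T.InfinitelyRenormalizable) {n : ℕ} {α : A} {u v w : List A}
    (huv : T.word n α = u ++ v) {y y' x x' : ℝ}
    (h : (rauzy^[n] T.toExchangeData).Follows (α :: w) y y') (hx : T.Follows u y x)
    (hx' : T.Follows u y' x') : T.Follows (v ++ w.flatMap (T.word n) ++ u) x x' := by
  have hf := h.flatMap fun β p hp => follows_word hT n hp
  rw [List.flatMap_cons, huv, List.append_assoc] at hf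
  exact (hf.of_append hx).append hx'

lemma sum_map_conj {n : ℕ} {α : A} {u v w : List A} (huv : T.word n α = u ++ v) :
    ((v ++ w.flatMap (T.word n) ++ u).map T.logSlope).sum =
      ((α :: w).map (rauzy^[n] T.toExchangeData).logSlope).sum := by
  rw [← List.sum_map_flatMap (fun β => (T.logSlope_iterate n β).symm), List.flatMap_cons, huv]
  simp only [List.map_append, List.sum_append]
  ring

/-- Arbitrarily long pieces of orbit that start at `x`, and others that end at `x`, with bounded
sums of the log-slopes. -/
lemma exists_follows_bounded_sum (hT : T.InfinitelyRenormalizable) {n : ℕ → ℕ} (hn : StrictMono n)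
    {N : ℕ} {K C : ℝ}
    (h1 : ∀ (k : ℕ) (α β : A), 1 ≤ T.heightCocycle (n k) (n k + N) α β)
    (hK : ∀ (k : ℕ) (α β : A), (T.heightCocycle (n k) (n k + N) α β : ℝ) ≤ K)
    (hC : ∀ k α, |(rauzy^[n k] T.toExchangeData).logSlope α| ≤ C)
    {x : ℝ} (hx : x ∈ Set.Ico 0 T.total) :
    ∃ B : ℝ, ∀ c : ℕ,
      (∃ w x', T.Follows w x x' ∧ c ≤ w.length ∧ |(w.map T.logSlope).sum| ≤ B) ∧
      ∃ w x', x' ∈ Set.Ico 0 T.total ∧ T.Follows w x' x ∧ c ≤ w.length ∧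
        |(w.map T.logSlope).sum| ≤ B := by
  obtain ⟨R, hR⟩ := exists_nat_ge (Fintype.card A * K)
  have hC0 : 0 ≤ C := (abs_nonneg _).trans (hC 0 (Classical.arbitrary A))
  refine ⟨(2 * R : ℕ) * C, fun c => ?_⟩
  obtain ⟨k, hk⟩ := T.exists_forall_le_length_word hn h1 c
  replace hk := hk (n k) (hn.id_le k)
  obtain ⟨S, hS, hSI⟩ := exists_eq_rauzy_iterate hT (n k)
  obtain ⟨α, y, u, v, hy, huv, hv, hu⟩ := exists_word_cover hT (n k) hx
  have hmem : ∀ α β, α ∈ S.word N β := by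
    intro α β
    have := h1 k β α
    rw [ExchangeData.heightCocycle_add, ← hS, ← ExchangeData.count_word] at this
    exact List.count_pos_iff.mp (by omega)
  have hlen : ∀ β, (S.word N β).length ≤ R := by
    intro β
    have : ((S.word N β).length : ℝ) ≤ Fintype.card A * K := by
      rw [ExchangeData.length_word, hS, ← ExchangeData.heightCocycle_add]
      simpa using Finset.sum_le_sum (s := Finset.univ) (fun γ _ => hK k β γ)
    exact_mod_cast this.trans hR
  have hreturn := exists_return hSI hmem hlen (α := α) (y := y) (by rwa [hS])
  rw [hS] at hreturn
  have hlong : ∀ w : List A, c ≤ (v ++ w.flatMap (T.word (n k)) ++ u).length := by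
    intro w
    have := hk α
    rw [huv] at this
    simp only [List.length_append] at this ⊢
    omega
  have hsum : ∀ w : List A, (α :: w).length ≤ 2 * R →
      |((v ++ w.flatMap (T.word (n k)) ++ u).map T.logSlope).sum| ≤ (2 * R : ℕ) * C := by
    intro w hw
    rw [sum_map_conj huv]
    exact (List.abs_sum_map_le (hC k) _).trans
      (mul_le_mul_of_nonneg_right (Nat.cast_le.mpr hw) hC0)
  have hfloor : ∀ y' ∈ (rauzy^[n k] T.toExchangeData).interval α, ∃ x', T.Follows u y' x' := by
    intro y' hy'
    have := follows_word hT (n k) hy'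
    rw [huv] at this
    exact this.of_append_left
  obtain ⟨⟨w, y', hy', hw, hwl⟩, w₁, y₁, hy₁, hw₁, hwl₁⟩ := hreturn
  constructor
  · obtain ⟨x', hx'⟩ := hfloor y' hy'
    exact ⟨_, x', follows_conj hT huv hw hu hx', hlong w, hsum w hwl⟩
  · obtain ⟨x', hx'⟩ := hfloor y₁ hy₁
    have hf := follows_conj hT huv hw₁ hx' hu
    refine ⟨_, x', ?_, hf, hlong w₁, hsum w₁ hwl₁⟩
    obtain ⟨a, v', rfl⟩ := List.exists_cons_of_ne_nil hv
    exact T.mem_Ico_of_mem_interval hf.1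

end AIET

/-! ### Birkhoff sums -/

section Birkhoff

variable {X : Type*} (T : Equiv.Perm X) (f : X → ℝ)

lemma zBirkhoffSum_natCast (n : ℕ) (x : X) :
    zBirkhoffSum T f n x = ∑ j ∈ Finset.range n, f ((T ^ j) x) := by
  rw [zBirkhoffSum, if_pos (Int.natCast_nonneg n)]
  refine Finset.sum_nbij' Int.toNat Int.ofNat ?_ ?_ ?_ ?_ ?_
  · intro j hj
    simp only [Finset.mem_Ico, Finset.mem_range] at hj ⊢
    omega
  · intro j hj
    simp only [Finset.mem_Ico, Finset.mem_range] at hj ⊢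
    simpa using hj
  · intro j hj
    simp only [Finset.mem_Ico] at hj
    simp [hj.1]
  · intro j _
    simp
  · intro j hj
    simp only [Finset.mem_Ico] at hj
    rw [← zpow_natCast, Int.toNat_of_nonneg hj.1]

lemma zBirkhoffSum_neg_natCast (n : ℕ) (x : X) :
    zBirkhoffSum T f (-n) ((T ^ n) x) = -zBirkhoffSum T f n x := by
  rcases Nat.eq_zero_or_pos n with rfl | hn
  · simp [zBirkhoffSum]
  rw [zBirkhoffSum, zBirkhoffSum, if_neg (by omega), if_pos (Int.natCast_nonneg n), neg_inj]
  refine Finset.sum_nbij' (· + (n : ℤ)) (· - (n : ℤ)) ?_ ?_ ?_ ?_ ?_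
  · intro j hj
    simp only [Finset.mem_Ico] at hj ⊢
    omega
  · intro j hj
    simp only [Finset.mem_Ico] at hj ⊢
    omega
  · intro j _
    simp
  · intro j _
    simp
  · intro j _
    rw [zpow_add, Equiv.Perm.mul_apply, zpow_natCast]

end Birkhoff

namespace AIET

variable {A : Type*} [Fintype A] {T : AIET A}

lemma stepFun_eq {x : ℝ} {α : A} (h : x ∈ T.interval α) (v : A → ℝ) : T.stepFun v x = v α := by
  unfold ExchangeData.stepFun
  rw [Finset.sum_eq_single α]
  · rw [if_pos h]
  · intro β _ hβ
    exact if_neg fun h' => hβ (T.eq_of_mem_interval h' h)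
  · simp

lemma coe_toPerm_pow_of_follows {w : List A} {x : T.Domain} {y : ℝ} (h : T.Follows w x y) :
    ((T.toPerm ^ w.length) x : ℝ) = y := by
  induction w generalizing x with
  | nil => exact h
  | cons a w ih =>
    rw [List.length_cons, pow_succ, Equiv.Perm.mul_apply]
    exact ih h.2

lemma zBirkhoffSum_of_follows {w : List A} {x : T.Domain} {y : ℝ} (h : T.Follows w x y)
    (v : A → ℝ) :
    zBirkhoffSum T.toPerm (fun y : T.Domain => T.stepFun v y) w.length x = (w.map v).sum := by
  rw [zBirkhoffSum_natCast]
  induction w generalizing x with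
  | nil => simp
  | cons a w ih =>
    have := ih (x := T.toPerm x) h.2
    rw [List.length_cons, Finset.sum_range_succ', List.map_cons, List.sum_cons, ← this, add_comm]
    simp only [pow_zero, Equiv.Perm.one_apply, pow_succ, Equiv.Perm.mul_apply, stepFun_eq h.1]

end AIET

theorem proposition4p2 {A : Type*} [Fintype A] [DecidableEq A] [Nontrivial A]
    (T₀ : AIET A) (hT₀ : T₀.IsIET) (hBC : T₀.BCCondition)
    (ω : A → ℝ) (hω : ω ∈ T₀.centralStable)
    (T : AIET A) (hT : T ∈ AIET.Aff T₀.rotationNumber ω) (x : T.Domain) :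
    ∃ m : ℤ → ℤ, Tendsto m atTop atTop ∧ Tendsto m atBot atBot ∧
      BddAbove (Set.range fun k : ℤ =>
        |zBirkhoffSum T.toPerm (fun y : T.Domain => T.stepFun ω y) (m k) x|) := by
  obtain ⟨-, rfl, hTI, hrot⟩ := hT
  obtain ⟨-, -, -, n, hn, ⟨N, K, -, hNK⟩, V, -, hV⟩ := hBC
  have hH := ExchangeData.heightCocycle_congr hrot
  obtain ⟨B, hB⟩ := AIET.exists_follows_bounded_sum (C := V * l1Norm T.logSlope) hTI hn
    (fun k α β => by rw [hH]; exact (hNK k α β).1) (fun k α β => by rw [hH]; exact (hNK k α β).2)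
    (fun k α => by
      rw [T.logSlope_iterate, T.sum_map_word, hH]
      exact (abs_le_l1Norm _ α).trans (hV k _ hω)) x.2
  choose hfwd hbwd using hB
  choose w x' hw hwl hwB using hfwd
  choose w₁ x₁ hx₁ hw₁ hwl₁ hwB₁ using hbwd
  refine ⟨fun k => if 0 ≤ k then (w k.toNat).length else -(w₁ (-k).toNat).length, ?_, ?_, B, ?_⟩
  · refine tendsto_atTop_mono' _ ?_ tendsto_id
    filter_upwards [eventually_ge_atTop 0] with k hk
    have := hwl k.toNat
    simp only [if_pos hk, id]
    omega
  · refine tendsto_atBot_mono' _ ?_ tendsto_id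
    filter_upwards [eventually_lt_atBot 0] with k hk
    have := hwl₁ (-k).toNat
    simp only [if_neg (not_le.mpr hk), id]
    omega
  · rintro _ ⟨k, rfl⟩
    by_cases hk : 0 ≤ k
    · simp only [if_pos hk]
      rw [AIET.zBirkhoffSum_of_follows (hw k.toNat)]
      exact hwB _
    · simp only [if_neg hk]
      set c := (-k).toNat
      have hx : x = (T.toPerm ^ (w₁ c).length) (⟨x₁ c, hx₁ c⟩ : T.Domain) :=
        Subtype.ext (AIET.coe_toPerm_pow_of_follows (x := ⟨x₁ c, hx₁ c⟩) (hw₁ c)).symm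
      rw [hx, zBirkhoffSum_neg_natCast, abs_neg,
        AIET.zBirkhoffSum_of_follows (x := ⟨x₁ c, hx₁ c⟩) (hw₁ c)]
      exact hwB₁ c
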